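/- Let $f:\mathbb{C}\to\mathbb{C}$ be a (complex-valued) harmonic function such that every $w\in\mathbb{C}$ has only finitely many preimages under $f$. Write $J_f=|f_z|^2-|f_{\bar z}|^2$ for the Jacobian of $f$, $S=\{z\in\mathbb{C}: J_f(z)=0\}$ for its critical set, and $\mu_f=f_{\bar z}/f_z$ for its complex dilatation (with $|\mu_f|=\infty$ where $f_z=0\neq f_{\bar z}$, and with points where $f_z=f_{\bar z}=0$ disregarded in suprema of $|\mu_f|$). Let $B(a,\rho)=\{z:|z-a|<\rho\}$, and let $d(z,S)$ be the distance from $z$ to $S$ ($=\infty$ if $S=\varnothing$). Suppose that $S$ is nowhere dense. Let $w_0\in\mathbb{C}$ be a point of the cluster set $C(f,\infty)$, i.e. there is some sequence tending to $\infty$ along which $f$ tends to $w_0$. Then every sequence $(z_n)$ in $\mathbb{C}$ with $z_n\to\infty$ and $f(z_n)\to w_0$ has a subsequence, again denoted $(z_n)$, for which at least one of the following holds: 1. $d(z_n,S)\to 0$ as $n\to\infty$. 2. $J_f(z_n)\to 0$ as $n\to\infty$. 3. There are no $\rho>0$ and finite constant $M$ such that $|J_f(z)/J_f(z_n)|<M$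 for all $n$ and all $z\in B(z_n,\rho)$. (If $J_f(z_n)=0$ for some $n$, the quotient is read as $0$ for that $n$; this reading only makes (3) harder to satisfy.) 4. There is no $\rho>0$ such that $\sup\{|\mu_f(z)| : n\in\mathbb{N},\ z\in\overline{B(z_n,\rho)}\}<1$. -/

import Mathlib

open Filter Topology
open scoped ENNReal

noncomputable section

namespace PlanarHarmonic

/-- The Wirtinger derivative `f_z = (f_x - i f_y) / 2`. -/
def dz (f : ℂ → ℂ) (z : ℂ) : ℂ :=
  (fderiv ℝ f z 1 - Complex.I * fderiv ℝ f z Complex.I) / 2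

/-- The Wirtinger derivative `f_{z̄} = (f_x + i f_y) / 2`. -/
def dzbar (f : ℂ → ℂ) (z : ℂ) : ℂ :=
  (fderiv ℝ f z 1 + Complex.I * fderiv ℝ f z Complex.I) / 2

/-- The Jacobian `J_f = |f_z|² - |f_{z̄}|²`. -/
def jacobian (f : ℂ → ℂ) (z : ℂ) : ℝ :=
  ‖dz f z‖ ^ 2 - ‖dzbar f z‖ ^ 2

/-- The critical set `S` of `f`. -/
def criticalSet (f : ℂ → ℂ) : Set ℂ :=
  {z | jacobian f z = 0}

/-- The modulus `|μ_f| = |f_{z̄}| / |f_z|` of the complex dilatation, with values in `[0, ∞]`: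
it is `∞` where `f_z = 0 ≠ f_{z̄}`, and `0` where `f_z = f_{z̄} = 0`, so that the latter points
do not influence suprema. -/
def dilatationAbs (f : ℂ → ℂ) (z : ℂ) : ℝ≥0∞ :=
  ‖dzbar f z‖ₑ / ‖dz f z‖ₑ

/-- The valence of `f` at `w`: the number of distinct preimages of `w`. -/
def valence (f : ℂ → ℂ) (w : ℂ) : ℕ∞ :=
  (f ⁻¹' {w}).encard

/-- The cluster set `C(f, ∞)` of `f` at infinity. -/
def clusterSet (f : ℂ → ℂ) : Set ℂ :=
  {w | ∃ z : ℕ → ℂ, Tendsto z atTop (cocompact ℂ) ∧ Tendsto (fun n => f (z n)) atTop (𝓝 w)}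

end PlanarHarmonic

end

/-!
The idea is a quantitative covering theorem. For harmonic `f` both `f_z` and the conjugate of
`f_z̄` are entire. Unless `J_f(z_n) → 0`, a subsequence satisfies `|J_f(z_n)| ≥ δ > 0`. Suppose
that along it the dilatation is bounded away from `1` and the Jacobian quotient is bounded: on
discs `B(z_n, r)` of a fixed radius, `|f_z̄| ≤ k |f_z|` with `k < 1` and `|J_f| ≤ M |J_f(z_n)|`. Since
`(1 - k²) |f_z|² ≤ J_f ≤ |f_z|²`, both Wirtinger derivatives are bounded on `B(z_n, r)` by `C |f_z(z_n)|` with `C` independent of `n`. By the Schwarz lemma they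
vary by at most a small multiple of `|f_z(z_n)|` on a disc `B(z_n, s)` with `s` independent of `n`.
There `f` is a small Lipschitz perturbation of its differential at `z_n`, which expands
by at least `(1 - k) |f_z(z_n)|`; hence `f (B(z_n, s))` contains a disc about `f(z_n)` whose radius
is at least `(1 - k) √δ s / 2` (`PlanarHarmonic.surjOn_closedBall_of_bounded`). As `f(z_n) → w₀`,
each of these discs contains `w₀` for large `n`, so `w₀` has a preimage within distance `s` of
`z_n`, and since `z_n → ∞` it has infinitely many preimages, against the finite valence.
-/

namespace PlanarHarmonic

open Metric Set InnerProductSpace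
open scoped ComplexConjugate NNReal

variable {f : ℂ → ℂ}

/-! ### Wirtinger derivatives of harmonic functions -/

lemma fderiv_apply_eq_dz_dzbar (f : ℂ → ℂ) (z v : ℂ) :
    fderiv ℝ f z v = dz f z * v + dzbar f z * conj v := by
  have h : v = v.re • (1 : ℂ) + v.im • Complex.I := by
    simp [Complex.re_add_im]
  have h' : conj v = v.re - v.im * Complex.I := by
    apply Complex.ext <;> simp
  conv_lhs => rw [h, map_add, map_smul, map_smul]
  rw [h', dz, dzbar]
  conv_rhs => rw [← Complex.re_add_im v]
  simp only [Complex.real_smul, Complex.add_re, Complex.add_im, Complex.ofReal_re,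
    Complex.ofReal_im, Complex.mul_re, Complex.mul_im, Complex.I_re, Complex.I_im, mul_zero,
    mul_one, sub_zero, zero_add, add_zero]
  linear_combination ((v.im : ℂ) * fderiv ℝ f z Complex.I) * Complex.I_sq

lemma fderiv_eq_re_add_im {z : ℂ} (hf : DifferentiableAt ℝ f z) (v : ℂ) :
    fderiv ℝ f z v =
      fderiv ℝ (fun w => (f w).re) z v + Complex.I * fderiv ℝ (fun w => (f w).im) z v := by
  have h1 : HasFDerivAt (fun w => (f w).re) (Complex.reCLM.comp (fderiv ℝ f z)) z :=
    Complex.reCLM.hasFDerivAt.comp z hf.hasFDerivAt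
  have h2 : HasFDerivAt (fun w => (f w).im) (Complex.imCLM.comp (fderiv ℝ f z)) z :=
    Complex.imCLM.hasFDerivAt.comp z hf.hasFDerivAt
  rw [h1.fderiv, h2.fderiv]
  simp [mul_comm Complex.I, Complex.re_add_im]

lemma differentiable_of_harmonicOnNhd (hf : HarmonicOnNhd f univ) : Differentiable ℝ f :=
  fun z => (hf z (mem_univ z)).1.differentiableAt two_ne_zero

lemma differentiable_dz (hf : HarmonicOnNhd f univ) : Differentiable ℂ (dz f) := by
  intro z
  have hu := HarmonicAt.differentiableAt_complex_partial
    ((hf z (mem_univ z)).comp_CLM Complex.reCLM)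
  have hv := HarmonicAt.differentiableAt_complex_partial
    ((hf z (mem_univ z)).comp_CLM Complex.imCLM)
  refine ((hu.add (hv.const_mul Complex.I)).div_const 2).congr_of_eventuallyEq
    (Eventually.of_forall fun w => ?_)
  have hd := differentiable_of_harmonicOnNhd hf w
  simp only [dz, fderiv_eq_re_add_im hd, Function.comp_def, Complex.reCLM_apply,
    Complex.imCLM_apply, Pi.add_apply]
  ring

lemma differentiable_conj_dzbar (hf : HarmonicOnNhd f univ) :
    Differentiable ℂ (fun z => conj (dzbar f z)) := by
  intro z
  have hu := HarmonicAt.differentiableAt_complex_partial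
    ((hf z (mem_univ z)).comp_CLM Complex.reCLM)
  have hv := HarmonicAt.differentiableAt_complex_partial
    ((hf z (mem_univ z)).comp_CLM Complex.imCLM)
  refine ((hu.sub (hv.const_mul Complex.I)).div_const 2).congr_of_eventuallyEq
    (Eventually.of_forall fun w => ?_)
  have hd := differentiable_of_harmonicOnNhd hf w
  simp only [dzbar, fderiv_eq_re_add_im hd, Function.comp_def, Complex.reCLM_apply,
    Complex.imCLM_apply, Pi.sub_apply, map_div₀, map_add, map_mul, Complex.conj_ofReal,
    Complex.conj_I, map_ofNat]
  ring

/-! ### Quantitative covering -/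

/-- A consequence of the Schwarz lemma. -/
lemma norm_sub_le_of_norm_le_on_ball {g : ℂ → ℂ} (hg : Differentiable ℂ g) {c z : ℂ} {r B : ℝ}
    (hB : ∀ w ∈ ball c r, ‖g w - g c‖ ≤ B) (hz : z ∈ ball c r) :
    ‖g z - g c‖ ≤ B / r * dist z c := by
  rw [← dist_eq_norm]
  exact Complex.dist_le_div_mul_dist_of_mapsTo_ball hg.differentiableOn
    (fun w hw => by simpa [dist_eq_norm] using hB w hw) hz

/-- At a point with `|f_z̄| ≤ k |f_z|`, `k < 1` and `f_z ≠ 0`, the differential `v ↦ f_z v + f_z̄ v̄`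
is invertible and its inverse has norm at most `1 / ((1 - k) |f_z|)`. -/
noncomputable def fderivRightInverse (f : ℂ → ℂ) (z : ℂ) (k : ℝ≥0) (hk : k < 1)
    (ha : 0 < ‖dz f z‖) (hb : ‖dzbar f z‖ ≤ k * ‖dz f z‖) :
    (fderiv ℝ f z).NonlinearRightInverse where
  toFun w := (conj (dz f z) * w - dzbar f z * conj w) / (jacobian f z : ℂ)
  nnnorm := ((1 - k) * ‖dz f z‖₊)⁻¹
  bound' w := by
    have hk' : (k : ℝ) < 1 := hk
    set A := ‖dz f z‖ with hA
    set B := ‖dzbar f z‖ with hB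
    have hBA : B < A := by nlinarith
    have hB0 : 0 ≤ B := norm_nonneg _
    have hJ : 0 < jacobian f z := by
      have : jacobian f z = (A - B) * (A + B) := by rw [jacobian]; ring
      rw [this]; nlinarith
    have hc : (((((1 - k) * ‖dz f z‖₊)⁻¹ : ℝ≥0)) : ℝ) = ((1 - k) * A)⁻¹ := by
      simp [NNReal.coe_sub hk.le, hA]
    rw [hc, norm_div, Complex.norm_real, Real.norm_of_nonneg hJ.le, div_le_iff₀ hJ]
    have h1 : ‖conj (dz f z) * w - dzbar f z * conj w‖ ≤ (A + B) * ‖w‖ := by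
      refine (norm_sub_le _ _).trans_eq ?_
      simp [hA, hB]; ring
    have hpos : 0 < (1 - k) * A := mul_pos (by linarith) ha
    have h2 : A + B ≤ ((1 - k) * A)⁻¹ * jacobian f z := by
      rw [inv_mul_eq_div, le_div_iff₀ hpos, jacobian, ← hA, ← hB]
      nlinarith
    calc _ ≤ (A + B) * ‖w‖ := h1
      _ ≤ (((1 - k) * A)⁻¹ * jacobian f z) * ‖w‖ := by gcongr
      _ = _ := by ring
  right_inv' w := by
    have hk' : (k : ℝ) < 1 := hk
    have hBA : ‖dzbar f z‖ < ‖dz f z‖ := by nlinarith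
    have hJ : jacobian f z ≠ 0 := by
      rw [jacobian]; nlinarith [norm_nonneg (dzbar f z)]
    have hJ' : (jacobian f z : ℂ) ≠ 0 := by exact_mod_cast hJ
    have hJe : (jacobian f z : ℂ) =
        dz f z * conj (dz f z) - dzbar f z * conj (dzbar f z) := by
      simp [jacobian, Complex.mul_conj']
    rw [fderiv_apply_eq_dz_dzbar]
    simp only [map_div₀, map_sub, map_mul, Complex.conj_conj, Complex.conj_ofReal]
    field_simp
    rw [hJe]; ring

/-- Quantitative covering: if the Wirtinger derivatives are controlled on `B(c, r)` by their size
at the centre, then the image of a concentric disc contains a disc of comparable size. -/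
theorem surjOn_closedBall_of_bounded (hf : HarmonicOnNhd f univ) {c : ℂ} {r s C : ℝ} {k : ℝ≥0}
    (hk : k < 1) (hr : 0 < r) (hs : 0 ≤ s) (hC : 0 ≤ C) (hsr : 4 * (C + 1) * s ≤ (1 - k) * r)
    (ha : 0 < ‖dz f c‖) (hb : ‖dzbar f c‖ ≤ k * ‖dz f c‖)
    (hz : ∀ w ∈ ball c r, ‖dz f w‖ ≤ C * ‖dz f c‖)
    (hzbar : ∀ w ∈ ball c r, ‖dzbar f w‖ ≤ C * ‖dz f c‖) :
    SurjOn f (closedBall c s) (closedBall (f c) ((1 - k) / 2 * ‖dz f c‖ * s)) := by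
  have hk' : (k : ℝ) < 1 := hk
  have hk0 : (0 : ℝ) ≤ k := k.2
  set A := ‖dz f c‖ with hA
  have hsr' : s < r := by
    have h1 : (1 - (k : ℝ)) * r ≤ r := by nlinarith
    nlinarith [mul_nonneg hC hs]
  have hsub : closedBall c s ⊆ ball c r := closedBall_subset_ball hsr'
  have key : ∀ w ∈ closedBall c s, ‖fderiv ℝ f w - fderiv ℝ f c‖ ≤ (1 - k) / 2 * A := by
    intro w hw
    have hws : dist w c ≤ s := hw
    have hBr : (C + 1) * A / r * dist w c ≤ (1 - k) / 4 * A := by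
      have h1 : (C + 1) * A / r * dist w c ≤ (C + 1) * A / r * s := by gcongr
      refine h1.trans ?_
      rw [div_mul_eq_mul_div, div_le_iff₀ hr]
      nlinarith
    have h1 : ‖dz f w - dz f c‖ ≤ (1 - k) / 4 * A := by
      refine (norm_sub_le_of_norm_le_on_ball (differentiable_dz hf) (fun x hx => ?_)
        (hsub hw)).trans hBr
      linarith [norm_sub_le (dz f x) (dz f c), hz x hx]
    have h2 : ‖dzbar f w - dzbar f c‖ ≤ (1 - k) / 4 * A := by
      have := (norm_sub_le_of_norm_le_on_ball (B := (C + 1) * A) (differentiable_conj_dzbar hf)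
        (fun x hx => ?_) (hsub hw)).trans hBr
      · rwa [← map_sub, RCLike.norm_conj] at this
      · rw [← map_sub, RCLike.norm_conj]
        nlinarith [norm_sub_le (dzbar f x) (dzbar f c), hzbar x hx]
    refine ContinuousLinearMap.opNorm_le_bound _ (by nlinarith) fun v => ?_
    have h3 : (fderiv ℝ f w - fderiv ℝ f c) v =
        (dz f w - dz f c) * v + (dzbar f w - dzbar f c) * conj v := by
      rw [sub_apply, fderiv_apply_eq_dz_dzbar, fderiv_apply_eq_dz_dzbar]
      ring
    rw [h3]
    refine (norm_add_le _ _).trans ?_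
    rw [norm_mul, norm_mul, RCLike.norm_conj]
    nlinarith [norm_nonneg v]
  have hε : ((((1 - k) / 2 * ‖dz f c‖₊ : ℝ≥0)) : ℝ) = (1 - k) / 2 * A := by
    simp [NNReal.coe_sub hk.le, hA]
  have happ : ApproximatesLinearOn f (fderiv ℝ f c) (closedBall c s)
      ((1 - k) / 2 * ‖dz f c‖₊) := by
    rw [ApproximatesLinearOn.approximatesLinearOn_iff_lipschitzOnWith]
    refine LipschitzOnWith.of_dist_le_mul fun x hx y hy => ?_
    rw [hε, dist_eq_norm, dist_eq_norm]
    have := (convex_closedBall c s).norm_image_sub_le_of_norm_fderiv_le'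
      (fun w _ => differentiable_of_harmonicOnNhd hf w) key hy hx
    simpa [map_sub, sub_sub_sub_comm] using this
  have := happ.surjOn_closedBall_of_nonlinearRightInverse
    (fderivRightInverse f c k hk ha hb) hs subset_rfl
  have hrad : (((fderivRightInverse f c k hk ha hb).nnnorm : ℝ)⁻¹ -
      (((1 - k) / 2 * ‖dz f c‖₊ : ℝ≥0) : ℝ)) = (1 - k) / 2 * A := by
    rw [hε]
    simp only [fderivRightInverse, NNReal.coe_inv, inv_inv, NNReal.coe_mul, NNReal.coe_sub hk.le,
      NNReal.coe_one, coe_nnnorm]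
    ring
  rwa [hrad] at this

/-! ### Uniform covering along a sequence -/

lemma norm_dzbar_le_of_dilatationAbs_le {z : ℂ} {k : ℝ≥0} (h : dilatationAbs f z ≤ k) :
    ‖dzbar f z‖ ≤ k * ‖dz f z‖ := by
  have h1 : ‖dzbar f z‖ₑ ≤ k * ‖dz f z‖ₑ := by
    rw [dilatationAbs] at h
    rwa [ENNReal.div_le_iff_le_mul (Or.inr ENNReal.coe_ne_top) (Or.inl enorm_ne_top)] at h
  have h2 : ‖dzbar f z‖₊ ≤ k * ‖dz f z‖₊ := by
    rw [enorm_eq_nnnorm, enorm_eq_nnnorm] at h1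
    exact_mod_cast h1
  exact_mod_cast h2

/-- If the Jacobian at the `z_n` is bounded away from `0`, the Jacobian quotients are bounded on
discs of a fixed radius, and the dilatation is bounded away from `1` there, then the
images of discs of a fixed radius about the `z_n` contain discs of a fixed radius about the
`f(z_n)`. -/
theorem exists_forall_surjOn_closedBall (hf : HarmonicOnNhd f univ) {z : ℕ → ℂ} {δ ρ M σ : ℝ}
    (hδ : 0 < δ) (hJ : ∀ n, δ ≤ |jacobian f (z n)|) (hρ : 0 < ρ)
    (hM : ∀ n, ∀ ζ ∈ ball (z n) ρ, |jacobian f ζ / jacobian f (z n)| < M)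
    (hσ : 0 < σ) (hμ : (⨆ n, ⨆ ζ ∈ closedBall (z n) σ, dilatationAbs f ζ) < 1) :
    ∃ s τ : ℝ, 0 < τ ∧ ∀ n, SurjOn f (closedBall (z n) s) (closedBall (f (z n)) τ) := by
  obtain ⟨k, hk⟩ := ENNReal.lt_iff_exists_coe.1 hμ |>.imp fun _ h => h.1.symm
  have hk1 : k < 1 := by rw [← hk] at hμ; exact_mod_cast hμ
  have hk' : (k : ℝ) < 1 := hk1
  have hk0 : (0 : ℝ) ≤ k := k.2
  have hdil : ∀ n, ∀ ζ ∈ closedBall (z n) σ, ‖dzbar f ζ‖ ≤ k * ‖dz f ζ‖ := fun n ζ hζ =>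
    norm_dzbar_le_of_dilatationAbs_le <| hk ▸ (le_iSup₂_of_le (f := fun ζ _ => dilatationAbs f ζ)
      ζ hζ le_rfl).trans (le_iSup (fun n => ⨆ ζ ∈ closedBall (z n) σ, dilatationAbs f ζ) n)
  have hJle : ∀ ζ, jacobian f ζ ≤ ‖dz f ζ‖ ^ 2 := fun ζ => by
    rw [jacobian]; nlinarith [sq_nonneg ‖dzbar f ζ‖]
  have hk2 : 0 < 1 - (k : ℝ) ^ 2 := by nlinarith
  have hleJ : ∀ n, ∀ ζ ∈ closedBall (z n) σ,
      (1 - (k : ℝ) ^ 2) * ‖dz f ζ‖ ^ 2 ≤ jacobian f ζ := fun n ζ hζ => by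
    have := pow_le_pow_left₀ (norm_nonneg _) (hdil n ζ hζ) 2
    rw [jacobian]; nlinarith
  have hJz : ∀ n, δ ≤ jacobian f (z n) := fun n => by
    have h0 : 0 ≤ jacobian f (z n) :=
      (by positivity : (0 : ℝ) ≤ (1 - (k : ℝ) ^ 2) * ‖dz f (z n)‖ ^ 2).trans
        (hleJ n _ (mem_closedBall_self hσ.le))
    simpa [abs_of_nonneg h0] using hJ n
  have hM0 : 0 < M := (abs_nonneg _).trans_lt (hM 0 (z 0) (mem_ball_self hρ))
  set r := min ρ σ with hr
  have hr0 : 0 < r := lt_min hρ hσ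
  -- Any `C ≥ 1` with `C ≥ M / (1 - k²)` serves, since then `C² ≥ M / (1 - k²)`.
  set C := M / (1 - (k : ℝ) ^ 2) + 1 with hC
  have hC1 : 1 ≤ C := by rw [hC]; have := div_pos hM0 hk2; linarith
  have hCM : M ≤ (1 - (k : ℝ) ^ 2) * C ^ 2 := by
    have h1 : M ≤ (1 - (k : ℝ) ^ 2) * C := by
      rw [hC, mul_add, mul_div_cancel₀ _ hk2.ne']; linarith
    nlinarith [mul_nonneg hk2.le (sub_nonneg.2 hC1)]
  have hdz : ∀ n, ∀ w ∈ ball (z n) r, ‖dz f w‖ ≤ C * ‖dz f (z n)‖ := fun n w hw => by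
    have hw1 : w ∈ ball (z n) ρ := ball_subset_ball (min_le_left _ _) hw
    have hw2 : w ∈ closedBall (z n) σ :=
      ball_subset_closedBall (ball_subset_ball (min_le_right _ _) hw)
    have hpos : 0 < jacobian f (z n) := hδ.trans_le (hJz n)
    have h1 : jacobian f w ≤ M * jacobian f (z n) := by
      rw [← div_le_iff₀ hpos]
      exact (le_abs_self _).trans (hM n w hw1).le
    refine (sq_le_sq₀ (norm_nonneg _) (by positivity)).1 ?_
    refine le_of_mul_le_mul_left ?_ hk2
    calc _ ≤ jacobian f w := hleJ n w hw2
      _ ≤ M * jacobian f (z n) := h1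
      _ ≤ M * ‖dz f (z n)‖ ^ 2 := by gcongr; exact hJle _
      _ ≤ ((1 - (k : ℝ) ^ 2) * C ^ 2) * ‖dz f (z n)‖ ^ 2 := by gcongr
      _ = _ := by ring
  have hA : ∀ n, √δ ≤ ‖dz f (z n)‖ := fun n =>
    Real.sqrt_le_iff.2 ⟨norm_nonneg _, (hJz n).trans (hJle _)⟩
  have hδ' : 0 < √δ := Real.sqrt_pos.2 hδ
  have h1k : 0 < 1 - (k : ℝ) := by linarith
  set s := (1 - (k : ℝ)) * r / (4 * (C + 1)) with hs
  have hs0 : 0 < s := by positivity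
  refine ⟨s, (1 - k) / 2 * √δ * s, by positivity, fun n => ?_⟩
  refine (surjOn_closedBall_of_bounded hf (r := r) (C := C) hk1 hr0 hs0.le (by linarith) ?_
    (hδ'.trans_le (hA n)) (hdil n _ (mem_closedBall_self hσ.le)) (hdz n) fun w hw => ?_).mono
    subset_rfl (closedBall_subset_closedBall ?_)
  · rw [hs, mul_div_cancel₀ _ (by positivity)]
  · have hw2 : w ∈ closedBall (z n) σ :=
      ball_subset_closedBall (ball_subset_ball (min_le_right _ _) hw)
    refine (hdil n w hw2).trans ((mul_le_of_le_one_left (norm_nonneg _) hk'.le).trans (hdz n w hw))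
  · have := hA n
    gcongr

/-- If a point `w₀` is hit within bounded distance of all late members of a sequence tending to
infinity, then it has infinitely many preimages. -/
lemma valence_eq_top_of_tendsto {z : ℕ → ℂ} (hz : Tendsto z atTop (cocompact ℂ)) {s : ℝ} {w₀ : ℂ}
    (h : ∀ᶠ n in atTop, ∃ ζ ∈ closedBall (z n) s, f ζ = w₀) : valence f w₀ = ⊤ := by
  rw [valence, encard_eq_top_iff]
  intro hfin
  have hc : IsCompact (cthickening s (f ⁻¹' {w₀})) := hfin.isCompact.cthickening
  obtain ⟨n, ⟨ζ, hζ, hfζ⟩, hn⟩ := (h.and (hz.eventually hc.compl_mem_cocompact)).exists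
  exact hn (mem_cthickening_of_dist_le (z n) ζ s _ hfζ (by rw [dist_comm]; exact hζ))

end PlanarHarmonic

theorem corollary1 (f : ℂ → ℂ)
    (hf : InnerProductSpace.HarmonicOnNhd f Set.univ)
    (hval : ∀ w : ℂ, PlanarHarmonic.valence f w < ⊤)
    (hS : IsNowhereDense (PlanarHarmonic.criticalSet f))
    (w₀ : ℂ) (hw₀ : w₀ ∈ PlanarHarmonic.clusterSet f)
    (z : ℕ → ℂ) (hz : Tendsto z atTop (cocompact ℂ))
    (hfz : Tendsto (fun n => f (z n)) atTop (𝓝 w₀)) :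
    ∃ φ : ℕ → ℕ, StrictMono φ ∧
      (Tendsto (fun n => Metric.infEDist (z (φ n)) (PlanarHarmonic.criticalSet f)) atTop (𝓝 0) ∨
        Tendsto (fun n => PlanarHarmonic.jacobian f (z (φ n))) atTop (𝓝 0) ∨
        (¬ ∃ ρ : ℝ, 0 < ρ ∧ ∃ M : ℝ, ∀ n : ℕ, ∀ ζ ∈ Metric.ball (z (φ n)) ρ,
          |PlanarHarmonic.jacobian f ζ / PlanarHarmonic.jacobian f (z (φ n))| < M) ∨
        (¬ ∃ ρ : ℝ, 0 < ρ ∧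
          (⨆ n : ℕ, ⨆ ζ ∈ Metric.closedBall (z (φ n)) ρ, PlanarHarmonic.dilatationAbs f ζ) < 1)) := by
  by_cases hJ : Tendsto (fun n => PlanarHarmonic.jacobian f (z n)) atTop (𝓝 0)
  · exact ⟨id, strictMono_id, Or.inr (Or.inl hJ)⟩
  obtain ⟨δ, hδ, hfreq⟩ : ∃ δ > 0, ∃ᶠ n in atTop, δ ≤ |PlanarHarmonic.jacobian f (z n)| := by
    rw [Metric.tendsto_nhds] at hJ
    push Not at hJ
    simpa [Real.dist_eq] using hJ
  obtain ⟨φ, hφ, hφJ⟩ := extraction_of_frequently_atTop hfreq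
  refine ⟨φ, hφ, ?_⟩
  by_contra! hcon
  obtain ⟨-, -, ⟨ρ, hρ, M, hM⟩, σ, hσ, hμ⟩ := hcon
  obtain ⟨s, τ, hτ, hsurj⟩ := PlanarHarmonic.exists_forall_surjOn_closedBall hf
    (z := fun n => z (φ n)) hδ hφJ hρ hM hσ hμ
  refine (hval w₀).ne (PlanarHarmonic.valence_eq_top_of_tendsto (s := s)
    (hz.comp hφ.tendsto_atTop) ?_)
  filter_upwards [(hfz.comp hφ.tendsto_atTop).eventually (Metric.closedBall_mem_nhds w₀ hτ)]
    with n hn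
  exact hsurj n (Metric.mem_closedBall_comm.1 hn)
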